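/- Let $A=\mathbb{C}[x_1,\dots,x_N]$ be a polynomial ring and let $I\subseteq A$ be an ideal whose zero locus $\mathcal{V}(I)\subseteq\mathbb{A}^N_{\mathbb{C}}$ is irreducible (in particular non-empty) of codimension $c$ in the Zariski topology. Let $$0\longrightarrow F_n\xrightarrow{\,d_n\,}F_{n-1}\longrightarrow\cdots\longrightarrow F_1\xrightarrow{\,d_1\,}F_0$$ be a resolution of $R=A/I$ by free $A$-modules of finite rank (so the sequence is exact except at $F_0$, and $F_0/\operatorname{im}d_1\cong A/I$). For each $k$ let $I(d_k)\subseteq A$ be the ideal generated by the $r\times r$ minors of a matrix of $d_k$, where $r$ is the largest size for which these minors do not all vanish (the $0\times 0$ minor is $1$, so $I(d_k)=A$ if $d_k=0$). For an ideal $J\subseteq A$ let $\operatorname{depth}(J)$ be the maximal length of an $A$-regular sequence contained in $J$, with $\operatorname{depth}(A)=\infty$. If $\operatorname{depth}(I(d_k))>k$ for all $k$ with $c<k\le n$, then $\sqrt{I}$ is the only associated prime of $I$ (that is, the set of associated primes of the $A$-module $A/I$ is exactly $\{\sqrt I\}$), and $R$ satisfies condition $(S_1)$: every prime ideal of $R$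 associated to zero has height $0$. -/

import Mathlib

noncomputable section

/-- Complex affine `N`-space, as the set of its `ℂ`-points. It is a separate type so that it carries
the Zariski topology and not the Euclidean one. -/
def ComplexAffineSpace (N : ℕ) : Type := Fin N → ℂ

/-- The zero locus in affine space of an ideal of the polynomial ring. -/
def zeroSet {N : ℕ} (I : Ideal (MvPolynomial (Fin N) ℂ)) : Set (ComplexAffineSpace N) :=
  {x | ∀ f ∈ I, MvPolynomial.eval x f = 0}

theorem zeroSet_top {N : ℕ} : zeroSet (⊤ : Ideal (MvPolynomial (Fin N) ℂ)) = ∅ := by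
  refine Set.eq_empty_of_forall_notMem fun x hx => ?_
  simpa using hx 1 Submodule.mem_top

theorem zeroSet_sSup {N : ℕ} (S : Set (Set (ComplexAffineSpace N)))
    (hS : S ⊆ Set.range (zeroSet (N := N))) : zeroSet (sSup {J | zeroSet J ∈ S}) = ⋂₀ S := by
  refine Set.Subset.antisymm (fun x hx t ht => ?_) (fun x hx => ?_)
  · obtain ⟨J, rfl⟩ := hS ht
    exact fun f hf => hx f ((le_sSup (show J ∈ {J | zeroSet J ∈ S} from ht)) hf)
  · have hle : sSup {J | zeroSet J ∈ S} ≤ RingHom.ker (MvPolynomial.eval x) :=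
      sSup_le fun J hJ f hf => RingHom.mem_ker.2 (hx _ hJ f hf)
    exact fun f hf => RingHom.mem_ker.1 (hle hf)

theorem zeroSet_mul {N : ℕ} (J K : Ideal (MvPolynomial (Fin N) ℂ)) :
    zeroSet (J * K) = zeroSet J ∪ zeroSet K := by
  refine Set.Subset.antisymm (fun x hx => ?_) (fun x hx => ?_)
  · by_cases hJ : x ∈ zeroSet J
    · exact Or.inl hJ
    · obtain ⟨f, hf⟩ := not_forall.1 hJ
      obtain ⟨hfJ, hfx⟩ := Classical.not_imp.1 hf
      refine Or.inr fun g hg => ?_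
      have h : MvPolynomial.eval x (f * g) = 0 := hx _ (Ideal.mul_mem_mul hfJ hg)
      rw [map_mul] at h
      exact (mul_eq_zero.1 h).resolve_left hfx
  · have hJ : J * K ≤ J := Ideal.mul_le_left
    have hK : J * K ≤ K := Ideal.mul_le_right
    rcases hx with hx | hx
    · exact fun f hf => hx f (hJ hf)
    · exact fun f hf => hx f (hK hf)

/-- The Zariski topology: the closed sets are the zero loci of ideals. -/
instance zariskiTopology (N : ℕ) : TopologicalSpace (ComplexAffineSpace N) :=
  TopologicalSpace.ofClosed (Set.range (zeroSet (N := N)))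
    ⟨⊤, zeroSet_top⟩
    (fun S hS => ⟨_, zeroSet_sSup S hS⟩)
    (by
      rintro _ ⟨J, rfl⟩ _ ⟨K, rfl⟩
      exact ⟨J * K, zeroSet_mul J K⟩)

/-- The codimension of a closed subset `S` of a topological space: the infimum, over the irreducible
closed sets `Z ⊆ S`, of the supremum of the lengths of the chains `Z = Z₀ ⊂ Z₁ ⊂ ⋯ ⊂ Zₗ` of
irreducible closed sets of the space. For irreducible `S` the infimum is attained at `Z = S`. -/
def topologicalCodim {X : Type*} [TopologicalSpace X] (S : Set X) : ℕ∞ :=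
  ⨅ (Z : TopologicalSpace.IrreducibleCloseds X) (_ : (Z : Set X) ⊆ S), Order.coheight Z

/-- For an irreducible closed set the codimension is the supremum of the lengths of the chains
of irreducible closed sets that start at it. -/
theorem topologicalCodim_coe {X : Type*} [TopologicalSpace X]
    (Z : TopologicalSpace.IrreducibleCloseds X) :
    topologicalCodim (Z : Set X) = Order.coheight Z :=
  le_antisymm (iInf₂_le Z (Set.Subset.refl _))
    (le_iInf₂ fun W hW => Order.coheight_anti (show W ≤ Z from hW))

/-- The depth of an ideal `J` on the ring: the supremum of the lengths of the regular sequences of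
`A` contained in `J`, with the usual convention that the unit ideal has infinite depth. -/
def idealDepth {A : Type*} [CommRing A] (J : Ideal A) : ℕ∞ :=
  open scoped Classical in
  if J = ⊤ then ⊤
  else ⨆ (rs : List A) (_ : RingTheory.Sequence.IsRegular A rs) (_ : ∀ a ∈ rs, a ∈ J),
    (rs.length : ℕ∞)

/-- The ideal generated by the `r × r` minors of a matrix. (A choice of rows or columns with a
repetition only contributes the generator zero; the `0 × 0` minor is one.) -/
def minorsIdeal {A m n : Type*} [CommRing A] (M : Matrix m n A) (r : ℕ) : Ideal A :=
  Ideal.span {a | ∃ (e : Fin r → m) (f : Fin r → n), a = (M.submatrix e f).det}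

/-- The largest `r` for which some `r × r` minor of the matrix does not vanish. -/
def minorsRank {A : Type*} [CommRing A] {p q : ℕ} (M : Matrix (Fin p) (Fin q) A) : ℕ :=
  sSup {r : ℕ | minorsIdeal M r ≠ ⊥}

/-- The ideal `I(d)` generated by the maximal nonvanishing minors of a matrix; for a zero matrix
it is the unit ideal. -/
def maximalMinorsIdeal {A : Type*} [CommRing A] {p q : ℕ} (M : Matrix (Fin p) (Fin q) A) :
    Ideal A :=
  minorsIdeal M (minorsRank M)

/-- The sequence `0 → Fₙ → ⋯ → F₁ → F₀ → M → 0`, with `d k : F (k + 1) → F k`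
and augmentation `ε : F 0 → M`, is exact (and `F k = 0` for `k > n`). When all `F k` are free,
this says that it is a free resolution of `M` of length at most `n`. -/
structure IsResolution {A : Type*} [CommRing A] {M : Type*} [AddCommGroup M] [Module A M]
    {F : ℕ → Type*} [∀ k, AddCommGroup (F k)] [∀ k, Module A (F k)]
    (d : ∀ k, F (k + 1) →ₗ[A] F k) (ε : F 0 →ₗ[A] M) (n : ℕ) : Prop where
  surjective : Function.Surjective ε
  exact_zero : Function.Exact (d 0) ε
  exact_succ : ∀ k, Function.Exact (d (k + 1)) (d k)
  eq_zero : ∀ k, n < k → Subsingleton (F k)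

/-- Condition `(S₁)`: every prime associated to zero has height zero. -/
def SatisfiesS1 (R : Type*) [CommRing R] : Prop :=
  ∀ P ∈ associatedPrimes R R, P.height = 0

end

/-! The point is that an associated prime `P` of `A/I` has height at most `c`. Then, since `√I` is a
prime of height at least `c` contained in `P`, the two coincide. Suppose `P` has height `k + 1 > c`.
An ideal inside `P` has depth at most the height of `P`, so if `k + 1 ≤ n` the depth hypothesis
forces some maximal minor `Δ` of `d_{k+1}` out of `P`. Over `A_P` this `Δ` is a unit, the cokernel
of `d_{k+1}` is a direct summand of `F_k`, and the resolution can be cut to length `k`; if `k + 1 >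
n` it is already short enough. But `A` is Cohen–Macaulay, so `P` contains an `A_P`-regular sequence
longer than this resolution. An induction on length, in place of Auslander–Buchsbaum, shows that no
nonzero element of `(A/I)_P` is killed by `P` (`eq_zero_of_forall_smul_eq_zero_of_resolution`), a
contradiction. -/

/-! ### Polynomial rings over a field are Cohen–Macaulay -/

-- The leading coefficients of `g` and `a` multiply to zero, so multiplying `a` by that of `g`
-- lowers its degree or kills it.
open Polynomial in
theorem Polynomial.exists_leadingCoeff_pow_mul_eq_zero {R : Type*} [CommRing R] (g a : R[X])
    (h : g * a = 0) : ∃ t : ℕ, C (g.leadingCoeff ^ t) * a = 0 := by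
  induction hn : a.natDegree using Nat.strong_induction_on generalizing a with
  | _ n ih =>
    by_cases h0 : C g.leadingCoeff * a = 0
    · exact ⟨1, by simpa using h0⟩
    have hlead : g.leadingCoeff * a.coeff n = 0 := by
      rw [← hn, ← Polynomial.leadingCoeff, ← Polynomial.coeff_mul_degree_add_degree, h, coeff_zero]
    have hle : (C g.leadingCoeff * a).natDegree ≤ n := hn ▸ natDegree_C_mul_le _ _
    have hne : (C g.leadingCoeff * a).natDegree ≠ n := fun he => by
      apply h0
      rw [← leadingCoeff_eq_zero, Polynomial.leadingCoeff, he, coeff_C_mul, hlead]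
    obtain ⟨t, ht⟩ := ih _ (lt_of_le_of_ne hle hne) (C g.leadingCoeff * a)
      (by rw [mul_left_comm, h, mul_zero]) rfl
    exact ⟨t + 1, by rw [pow_succ, C_mul, mul_assoc, ht]⟩

/-- Weak regularity of a sequence on the localization of the ring at the complement of `P`. -/
def IsLocallyWeaklyRegular {A : Type*} [CommRing A] (P : Ideal A) (rs : List A) : Prop :=
  ∀ (i : ℕ) (h : i < rs.length) (a : A), rs[i] * a ∈ Ideal.ofList (rs.take i) →
    ∃ s, s ∉ P ∧ s * a ∈ Ideal.ofList (rs.take i)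

theorem IsLocallyWeaklyRegular.append_singleton {A : Type*} [CommRing A] {P : Ideal A}
    {rs : List A} (h : IsLocallyWeaklyRegular P rs) {g : A}
    (hg : ∀ a, g * a ∈ Ideal.ofList rs → ∃ s, s ∉ P ∧ s * a ∈ Ideal.ofList rs) :
    IsLocallyWeaklyRegular P (rs ++ [g]) := by
  intro i hi a ha
  rcases Nat.lt_or_ge i rs.length with hlt | hge
  · rw [List.take_append_of_le_length hlt.le] at ha ⊢
    rw [List.getElem_append_left hlt] at ha
    exact h i hlt a ha
  · have hi' : i = rs.length := by simp at hi; omega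
    subst hi'
    simp only [List.take_left', List.getElem_concat_length] at ha ⊢
    exact hg a ha

open Polynomial in
theorem IsLocallyWeaklyRegular.map_C {R : Type*} [CommRing R] {P : Ideal R[X]} [P.IsPrime]
    {rs : List R} (h : IsLocallyWeaklyRegular (P.comap C) rs) :
    IsLocallyWeaklyRegular P (rs.map C) := by
  intro i hi a ha
  have hi' : i < rs.length := by simpa using hi
  rw [← List.map_take, ← Ideal.map_ofList, Ideal.mem_map_C_iff] at ha
  simp only [List.getElem_map, coeff_C_mul] at ha
  choose s hs hsa using fun n => h i hi' _ (ha n)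
  -- Membership is tested coefficientwise; the product is a common multiplier, outside `P` by
  -- primality.
  refine ⟨C (∏ n ∈ a.support, s n), ?_, ?_⟩
  · rw [← Ideal.mem_comap]
    intro hmem
    obtain ⟨n, -, hn⟩ := (Ideal.IsPrime.prod_mem_iff (p := P.comap C)).1 hmem
    exact hs n hn
  · rw [← List.map_take, ← Ideal.map_ofList, Ideal.mem_map_C_iff]
    intro n
    rw [coeff_C_mul]
    by_cases hn : n ∈ a.support
    · rw [← Finset.mul_prod_erase _ _ hn, mul_right_comm]
      exact Ideal.mul_mem_right _ _ (hsa n)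
    · rw [notMem_support_iff.1 hn, mul_zero]
      exact Ideal.zero_mem _

-- Otherwise leading terms could be subtracted one by one without leaving `P`, making every element
-- of `P` a combination of constants in `P`.
open Polynomial in
theorem Polynomial.exists_mem_leadingCoeff_notMem {R : Type*} [CommRing R] {P : Ideal R[X]}
    (h : ¬ P ≤ (P.comap C).map C) : ∃ g ∈ P, g.leadingCoeff ∉ P.comap C := by
  by_contra! hall
  apply h
  intro g hg
  induction hn : g.natDegree using Nat.strong_induction_on generalizing g with
  | _ n ih =>
    have hl : C g.leadingCoeff ∈ P := hall g hg
    have hm : C g.leadingCoeff * X ^ g.natDegree ∈ (P.comap C).map C :=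
      Ideal.mul_mem_right _ _ (Ideal.mem_map_of_mem _ (hall g hg))
    have he := g.eraseLead_add_C_mul_X_pow
    by_cases h0 : g.natDegree = 0
    · rw [eq_C_of_natDegree_eq_zero h0]
      apply Ideal.mem_map_of_mem
      rw [Ideal.mem_comap, ← eq_C_of_natDegree_eq_zero h0]
      exact hg
    · rw [← he]
      refine Ideal.add_mem _ (ih g.eraseLead.natDegree ?_ ?_ rfl) hm
      · exact hn ▸ lt_of_le_of_lt (eraseLead_natDegree_le g) (by omega)
      · rw [← self_sub_C_mul_X_pow]
        exact Ideal.sub_mem _ hg (Ideal.mul_mem_right _ _ hl)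

-- Modulo `J`, a power of the leading coefficient of `g` kills `a`, and that coefficient is a unit
-- at `P`.
open Polynomial in
theorem Polynomial.exists_notMem_mul_mem_map_C {R : Type*} [CommRing R] {P : Ideal R[X]}
    [P.IsPrime] (J : Ideal R) {g : R[X]} (hg : g.leadingCoeff ∉ P.comap C) (a : R[X])
    (ha : g * a ∈ J.map C) (hJ : J ≤ P.comap C) :
    ∃ s, s ∉ P ∧ s * a ∈ J.map C := by
  have key (b : R[X]) : b ∈ J.map C ↔ b.map (Ideal.Quotient.mk J) = 0 := by
    rw [Ideal.mem_map_C_iff, Polynomial.ext_iff]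
    simp [Ideal.Quotient.eq_zero_iff_mem]
  rw [key, Polynomial.map_mul] at ha
  obtain ⟨t, ht⟩ := exists_leadingCoeff_pow_mul_eq_zero _ _ ha
  refine ⟨C (g.leadingCoeff ^ t), ?_, ?_⟩
  · rw [C_pow]
    exact fun hmem => hg (Ideal.IsPrime.mem_of_pow_mem ‹P.IsPrime› t hmem)
  · rw [key, Polynomial.map_mul, map_C, map_pow]
    rwa [leadingCoeff_map_of_leadingCoeff_ne_zero] at ht
    exact fun h0 => hg (hJ (Ideal.Quotient.eq_zero_iff_mem.1 h0))

-- Inverting the nonzero constants preserves the height of `P` and lands in the one-dimensional ring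
-- `K[X]`.
attribute [local instance] Polynomial.algebra Polynomial.isLocalization in
open Polynomial in
theorem Polynomial.height_le_one_of_comap_C_eq_bot {D : Type*} [CommRing D] [IsDomain D]
    [IsNoetherianRing D] (P : Ideal D[X]) [P.IsPrime] (h : P.comap C = ⊥) : P.height ≤ 1 := by
  let K := FractionRing D
  have hdisj : Disjoint (((nonZeroDivisors D).map (C : D →+* D[X]) : Submonoid D[X]) : Set D[X])
      (P : Set D[X]) := by
    rw [Set.disjoint_left]
    rintro _ ⟨b, hb, rfl⟩ hP
    have : b ∈ P.comap C := hP
    rw [h, Ideal.mem_bot] at this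
    exact nonZeroDivisors.ne_zero hb this
  have hprime : (P.map (algebraMap D[X] K[X])).IsPrime :=
    IsLocalization.isPrime_of_isPrime_disjoint ((nonZeroDivisors D).map (C : D →+* D[X])) _ P
      ‹_› hdisj
  rw [← IsLocalization.height_map_of_disjoint (S := K[X])
    ((nonZeroDivisors D).map (C : D →+* D[X])) P hdisj]
  have := Ideal.height_le_ringKrullDim_of_ne_top hprime.ne_top
  rw [ringKrullDim_of_isNoetherianRing, ringKrullDim_eq_zero_of_field, zero_add] at this
  exact_mod_cast this

open Polynomial in
theorem Polynomial.height_le_height_comap_C_add_one {R : Type*} [CommRing R] [IsNoetherianRing R]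
    (P : Ideal R[X]) [P.IsPrime] : P.height ≤ (P.comap C).height + 1 := by
  have : P.LiesOver (P.comap C) := ⟨rfl⟩
  have hle : (P.comap C).map C ≤ P := Ideal.map_comap_le
  refine (Ideal.height_le_height_add_of_liesOver (P.comap C) P).trans (add_le_add le_rfl ?_)
  let p := P.comap C
  let e : (R ⧸ p)[X] ≃+* (R[X] ⧸ (p.map (C : R →+* R[X]))) :=
    Ideal.polynomialQuotientEquivQuotientPolynomial p
  let Q := P.map (Ideal.Quotient.mk (p.map (C : R →+* R[X])))
  have hQ : Q.IsPrime := Ideal.isPrime_map_quotientMk_of_isPrime hle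
  change Q.height ≤ 1
  rw [← RingEquiv.height_comap e]
  have : (Q.comap e).IsPrime := Ideal.IsPrime.comap _
  apply height_le_one_of_comap_C_eq_bot
  rw [eq_bot_iff]
  intro x hx
  obtain ⟨x, rfl⟩ := Ideal.Quotient.mk_surjective x
  rw [Ideal.mem_comap, Ideal.mem_comap] at hx
  have hx' : e (C (Ideal.Quotient.mk p x)) = Ideal.Quotient.mk (p.map (C : R →+* R[X])) (C x) := by
    have := Ideal.polynomialQuotientEquivQuotientPolynomial_map_mk p (C x)
    rwa [map_C] at this
  rw [hx', Ideal.mem_quotient_iff_mem hle] at hx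
  rw [Ideal.mem_bot, Ideal.Quotient.eq_zero_iff_mem]
  exact hx

open Polynomial in
theorem Polynomial.height_le_height_comap_C {R : Type*} [CommRing R] [IsNoetherianRing R]
    (P : Ideal R[X]) [P.IsPrime] (h : P ≤ (P.comap C).map C) : P.height ≤ (P.comap C).height := by
  have : P.LiesOver (P.comap C) := ⟨rfl⟩
  have hle : (P.comap C).map C ≤ P := Ideal.map_comap_le
  have heq : (P.comap C).map C = P := le_antisymm hle h
  refine (Ideal.height_le_height_add_of_liesOver (P.comap C) P).trans ?_
  change _ + (P.map (Ideal.Quotient.mk ((P.comap C).map C))).height ≤ _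
  rw [heq, Ideal.map_quotient_self, Ideal.height_bot, add_zero]

/-- Every prime of the ring contains a sequence at least as long as its height that is weakly regular
locally at the prime. For Noetherian rings this is the Cohen–Macaulay property. -/
def HasLongRegularSequences (A : Type*) [CommRing A] : Prop :=
  ∀ (P : Ideal A) [P.IsPrime], ∃ rs : List A,
    (∀ r ∈ rs, r ∈ P) ∧ IsLocallyWeaklyRegular P rs ∧ P.height ≤ rs.length

theorem HasLongRegularSequences.of_field (K : Type*) [Field K] : HasLongRegularSequences K := by
  intro P _
  refine ⟨[], by simp, fun i hi => by simp at hi, ?_⟩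
  rw [Ideal.eq_bot_of_prime P, Ideal.height_bot]
  simp

-- A sequence for the contraction `p` suffices when `P = pR[X]`. Otherwise the height grows by at
-- most one, and a `g ∈ P` with leading coefficient outside `p` extends the sequence.
open Polynomial in
theorem HasLongRegularSequences.polynomial {R : Type*} [CommRing R] [IsNoetherianRing R]
    (h : HasLongRegularSequences R) : HasLongRegularSequences R[X] := by
  intro P _
  obtain ⟨rs, hmem, hreg, hlen⟩ := h (P.comap C)
  have hmemC : ∀ r ∈ rs.map C, r ∈ P := by
    intro r hr
    obtain ⟨x, hx, rfl⟩ := List.mem_map.1 hr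
    exact hmem x hx
  by_cases hP : P ≤ (P.comap C).map C
  · exact ⟨rs.map C, hmemC, hreg.map_C, by
      simpa using (Polynomial.height_le_height_comap_C P hP).trans hlen⟩
  · obtain ⟨g, hgP, hg⟩ := Polynomial.exists_mem_leadingCoeff_notMem hP
    refine ⟨rs.map C ++ [g], ?_, hreg.map_C.append_singleton fun a ha => ?_, ?_⟩
    · intro r hr
      rcases List.mem_append.1 hr with hr | hr
      · exact hmemC r hr
      · rw [List.mem_singleton.1 hr]; exact hgP
    · rw [← Ideal.map_ofList] at ha ⊢
      exact Polynomial.exists_notMem_mul_mem_map_C _ hg a ha (Ideal.span_le.2 hmem)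
    · refine (Polynomial.height_le_height_comap_C_add_one P).trans ?_
      simpa using add_le_add hlen (le_refl 1)

theorem HasLongRegularSequences.of_ringEquiv {A B : Type*} [CommRing A] [CommRing B] (e : A ≃+* B)
    (h : HasLongRegularSequences A) : HasLongRegularSequences B := by
  intro P _
  have hp : (P.comap e).IsPrime := Ideal.IsPrime.comap _
  obtain ⟨rs, hmem, hreg, hlen⟩ := h (P.comap e)
  have hl (l : List A) (b : B) :
      b ∈ Ideal.ofList (l.map (e : A →+* B)) ↔ e.symm b ∈ Ideal.ofList l := by
    rw [← Ideal.map_ofList]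
    exact Ideal.mem_map_of_equiv e b |>.trans
      ⟨fun ⟨x, hx, hxb⟩ => by rwa [← hxb, e.symm_apply_apply], fun hx => ⟨_, hx, by simp⟩⟩
  refine ⟨rs.map (e : A →+* B), ?_, ?_, ?_⟩
  · intro r hr
    obtain ⟨x, hx, rfl⟩ := List.mem_map.1 hr
    exact hmem x hx
  · intro i hi b hb
    rw [← List.map_take, hl] at hb
    simp only [List.getElem_map, map_mul, RingEquiv.coe_toRingHom, e.symm_apply_apply] at hb
    obtain ⟨s, hs, hsb⟩ := hreg i (by simpa using hi) _ hb
    refine ⟨e s, hs, ?_⟩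
    rw [← List.map_take, hl]
    simpa using hsb
  · rw [RingEquiv.height_comap] at hlen
    simpa using hlen

theorem HasLongRegularSequences.mvPolynomial_fin (K : Type*) [Field K] (n : ℕ) :
    HasLongRegularSequences (MvPolynomial (Fin n) K) := by
  induction n with
  | zero =>
    exact (HasLongRegularSequences.of_field K).of_ringEquiv
      (MvPolynomial.isEmptyAlgEquiv K (Fin 0)).symm.toRingEquiv
  | succ n ih => exact ih.polynomial.of_ringEquiv (MvPolynomial.finSuccEquiv K n).symm.toRingEquiv

/-! ### Regular sequences on localizations and along resolutions -/

theorem IsLocallyWeaklyRegular.isWeaklyRegular_localization {A : Type*} [CommRing A] {P : Ideal A}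
    [P.IsPrime] {rs : List A} (h : IsLocallyWeaklyRegular P rs) :
    RingTheory.Sequence.IsWeaklyRegular (Localization P.primeCompl) rs := by
  rw [← RingTheory.Sequence.isWeaklyRegular_map_algebraMap_iff (Localization P.primeCompl)]
  constructor
  intro i hi
  rw [isSMulRegular_iff_right_eq_zero_of_smul]
  intro x hx
  obtain ⟨x, rfl⟩ := Submodule.Quotient.mk_surjective _ x
  rw [← Submodule.Quotient.mk_smul, Submodule.Quotient.mk_eq_zero] at hx
  rw [Submodule.Quotient.mk_eq_zero]
  rw [← List.map_take, ← Ideal.map_ofList, smul_eq_mul, Ideal.mul_top] at hx ⊢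
  obtain ⟨a, s, rfl⟩ := IsLocalization.exists_mk'_eq P.primeCompl x
  have hi' : i < rs.length := by simpa using hi
  rw [List.getElem_map, smul_eq_mul, IsLocalization.mul_mk'_eq_mk'_of_mul,
    IsLocalization.mk'_mem_iff, IsLocalization.algebraMap_mem_map_algebraMap_iff P.primeCompl] at hx
  rw [IsLocalization.mk'_mem_iff, IsLocalization.algebraMap_mem_map_algebraMap_iff P.primeCompl]
  obtain ⟨m, hm, hma⟩ := hx
  obtain ⟨t, ht, hta⟩ := h i hi' (m * a) (by rwa [mul_left_comm] at hma)
  exact ⟨t * m, P.primeCompl.mul_mem ht hm, by rwa [mul_assoc]⟩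

open RingTheory.Sequence in
/-- If `K 0` has a resolution of length `m` whose terms, including the last syzygy module `K m`, admit
`rs` as a weakly regular sequence, and `rs` is longer than `m`, then no nonzero element of `K 0` is
annihilated by `rs`. -/
theorem eq_zero_of_forall_smul_eq_zero_of_resolution {A : Type*} [CommRing A] (m : ℕ) :
    ∀ (K F : ℕ → Type u) [∀ i, AddCommGroup (K i)] [∀ i, AddCommGroup (F i)]
      [∀ i, Module A (K i)] [∀ i, Module A (F i)]
      (f : ∀ i, K (i + 1) →ₗ[A] F i) (g : ∀ i, F i →ₗ[A] K i)
      (_ : ∀ i < m, Function.Injective (f i)) (_ : ∀ i < m, Function.Exact (f i) (g i))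
      (_ : ∀ i < m, Function.Surjective (g i)) (rs : List A) (_ : m < rs.length)
      (_ : ∀ i < m, IsWeaklyRegular (F i) rs) (_ : IsWeaklyRegular (K m) rs)
      (z : K 0) (_ : ∀ r ∈ rs, r • z = 0), z = 0 := by
  induction m with
  | zero =>
    intro K F _ _ _ _ f g _ _ _ rs hlen _ hK z hz
    obtain _ | ⟨x, rs⟩ := rs
    · simp at hlen
    · exact ((isWeaklyRegular_cons_iff _ _ _).1 hK).1.right_eq_zero_of_smul (hz x (by simp))
  | succ m ih =>
    intro K F _ _ _ _ f g hf hfg hg rs hlen hF hK z hz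
    obtain _ | ⟨x, rs⟩ := rs
    · simp at hlen
    have hxF : ∀ i < m + 1, IsSMulRegular (F i) x := fun i hi =>
      ((isWeaklyRegular_cons_iff _ _ _).1 (hF i hi)).1
    have hxK : ∀ i < m + 1, IsSMulRegular (K (i + 1)) x := fun i hi =>
      (hxF i hi).of_injective (f i) (hf i hi)
    obtain ⟨y, rfl⟩ := hg 0 m.succ_pos z
    have hlift : ∀ r ∈ x :: rs, ∃ w, f 0 w = r • y := fun r hr =>
      (hfg 0 m.succ_pos _).1 (by rw [map_smul]; exact hz r hr)
    obtain ⟨w, hw⟩ := hlift x (by simp)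
    -- Induction applies to `K 1` modulo `x`. The index shift matters: `x` is regular on the
    -- syzygies `K (i + 1)`, which embed in `F i`, but perhaps not on `K 0`.
    have hw0 : (Submodule.Quotient.mk w : QuotSMulTop x (K 1)) = 0 := by
      refine ih (fun i => QuotSMulTop x (K (i + 1))) (fun i => QuotSMulTop x (F (i + 1)))
        (fun i => QuotSMulTop.map x (f (i + 1))) (fun i => QuotSMulTop.map x (g (i + 1)))
        ?_ ?_ ?_ rs (by simpa using hlen) ?_ ?_ _ ?_
      · intro i hi
        rw [injective_iff_map_eq_zero]
        intro v hv
        obtain ⟨v, rfl⟩ := Submodule.Quotient.mk_surjective _ v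
        rw [QuotSMulTop.map_apply_mk, Submodule.Quotient.mk_eq_zero,
          Submodule.mem_smul_pointwise_iff_exists] at hv
        obtain ⟨u, -, hu⟩ := hv
        have hgu : g (i + 1) u = 0 := by
          refine (hxK i (by omega)).right_eq_zero_of_smul ?_
          rw [← map_smul, hu]
          exact (hfg (i + 1) (by omega)).apply_apply_eq_zero v
        obtain ⟨v', rfl⟩ := (hfg (i + 1) (by omega) _).1 hgu
        rw [← map_smul] at hu
        rw [Submodule.Quotient.mk_eq_zero, Submodule.mem_smul_pointwise_iff_exists]
        exact ⟨v', trivial, hf (i + 1) (by omega) hu⟩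
      · exact fun i hi => QuotSMulTop.map_exact x (hfg _ (by omega)) (hg _ (by omega))
      · exact fun i hi => QuotSMulTop.map_surjective x (hg _ (by omega))
      · exact fun i hi => ((isWeaklyRegular_cons_iff _ _ _).1 (hF (i + 1) (by omega))).2
      · exact ((isWeaklyRegular_cons_iff _ _ _).1 hK).2
      · intro r hr
        obtain ⟨w', hw'⟩ := hlift r (by simp [hr])
        rw [← Submodule.Quotient.mk_smul, Submodule.Quotient.mk_eq_zero,
          Submodule.mem_smul_pointwise_iff_exists]
        refine ⟨w', trivial, hf 0 m.succ_pos ?_⟩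
        rw [map_smul, map_smul, hw, hw', smul_comm]
    -- Now `w = x v`, so `x y = x f(v)`; cancelling `x` gives `y = f(v)`, which dies in `K 0`.
    rw [Submodule.Quotient.mk_eq_zero, Submodule.mem_smul_pointwise_iff_exists] at hw0
    obtain ⟨v, -, rfl⟩ := hw0
    rw [map_smul] at hw
    rw [← hxF 0 m.succ_pos hw]
    exact (hfg 0 m.succ_pos).apply_apply_eq_zero v

/-! ### Retracts and split cokernels -/

namespace RingTheory.Sequence

theorem IsWeaklyRegular.of_leftInverse {A : Type*} [CommRing A] {rs : List A} :
    ∀ {K : Type u} {F : Type v} [AddCommGroup K] [Module A K] [AddCommGroup F] [Module A F]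
      (i : K →ₗ[A] F) (p : F →ₗ[A] K) (_ : p ∘ₗ i = LinearMap.id) (_ : IsWeaklyRegular F rs),
      IsWeaklyRegular K rs := by
  induction rs with
  | nil => intros; exact .nil _ _
  | cons x rs ih =>
    intro K F _ _ _ _ i p hpi hF
    rw [isWeaklyRegular_cons_iff] at hF ⊢
    refine ⟨hF.1.of_injective i ?_, ih (QuotSMulTop.map x i) (QuotSMulTop.map x p) ?_ hF.2⟩
    · exact Function.LeftInverse.injective (g := p) fun k => LinearMap.congr_fun hpi k
    · rw [← QuotSMulTop.map_comp, hpi, QuotSMulTop.map_id]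

theorem IsWeaklyRegular.of_bijective_comp {A : Type*} [CommRing A] {rs : List A} {K : Type u}
    {F : Type v} [AddCommGroup K] [Module A K] [AddCommGroup F] [Module A F]
    (i : K →ₗ[A] F) (p : F →ₗ[A] K) (hpi : Function.Bijective (p ∘ₗ i))
    (hF : IsWeaklyRegular F rs) : IsWeaklyRegular K rs := by
  let u := LinearEquiv.ofBijective _ hpi
  refine hF.of_leftInverse (i ∘ₗ u.symm.toLinearMap) p ?_
  ext k
  exact u.apply_symm_apply k

theorem IsWeaklyRegular.localizedModule_of_flat {A : Type*} [CommRing A] (S : Submonoid A)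
    {rs : List A} (h : IsWeaklyRegular (Localization S) rs) (F : Type*) [AddCommGroup F]
    [Module A F] [Module.Flat A F] : IsWeaklyRegular (LocalizedModule S F) rs := by
  have e := ((LocalizedModule.equivTensorProduct S F).restrictScalars A)
  rw [e.isWeaklyRegular_congr]
  exact h.isWeaklyRegular_rTensor

/-- The cokernel of a map `d` with a `Δ`-quasi-inverse is a retract of the target after
inverting `Δ`. -/
theorem IsWeaklyRegular.localizedModule_coker {A : Type*} [CommRing A] (S : Submonoid A)
    {rs : List A} {F : Type*} {G : Type*} [AddCommGroup F] [Module A F] [AddCommGroup G]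
    [Module A G] (h : IsWeaklyRegular (LocalizedModule S F) rs) (d : G →ₗ[A] F) (ψ : F →ₗ[A] G)
    {Δ : A} (hΔ : Δ ∈ S) (hψ : d ∘ₗ ψ ∘ₗ d = Δ • d) :
    IsWeaklyRegular (LocalizedModule S (F ⧸ LinearMap.range d)) rs := by
  -- `Δ - dψ` kills the range of `d`, and projecting it back to the cokernel leaves `Δ`, a unit
  -- after localization.
  let φ : (F ⧸ LinearMap.range d) →ₗ[A] F :=
    (LinearMap.range d).liftQ (Δ • LinearMap.id - d ∘ₗ ψ) <| by
      rintro _ ⟨x, rfl⟩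
      have := LinearMap.congr_fun hψ x
      simp only [LinearMap.comp_apply, LinearMap.smul_apply] at this
      simp [this]
  let fK := LocalizedModule.mkLinearMap S (F ⧸ LinearMap.range d)
  let fF := LocalizedModule.mkLinearMap S F
  refine h.of_bijective_comp (IsLocalizedModule.map S fK fF φ)
    (IsLocalizedModule.map S fF fK (LinearMap.range d).mkQ) ?_
  have hcomp : (LinearMap.range d).mkQ ∘ₗ φ = algebraMap A (Module.End A _) Δ := by
    refine Submodule.linearMap_qext _ ?_
    ext x
    simp [φ]
  rw [← IsLocalizedModule.map_comp', hcomp]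
  have : IsLocalizedModule.map S fK fK (algebraMap A (Module.End A _) Δ) =
      algebraMap A (Module.End A _) Δ := by
    refine IsLocalizedModule.ext S fK (IsLocalizedModule.map_units fK) ?_
    ext x
    simp
  rw [this]
  exact (Module.End.isUnit_iff _).1 (IsLocalizedModule.map_units fK ⟨Δ, hΔ⟩)

end RingTheory.Sequence

/-! ### Maximal minors and quasi-inverses -/

/-- Bordering the minor by row `i` and column `j` gives a vanishing determinant; its Schur
complement, cleared of denominators, is the identity at entry `(i, j)`. -/
theorem Matrix.det_smul_eq_mul_adjugate_mul {A : Type*} [CommRing A] [IsDomain A] {m n : Type*}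
    (M : Matrix m n A) {r : ℕ} (e : Fin r → m) (f : Fin r → n)
    (h0 : (M.submatrix e f).det ≠ 0) (hM : minorsIdeal M (r + 1) = ⊥) :
    (M.submatrix e f).det • M =
      M.submatrix id f * (M.submatrix e f).adjugate * M.submatrix e id := by
  ext i j
  set B := M.submatrix e f with hB
  let E : Matrix (Fin r) (Fin 1) A := M.submatrix e (fun _ => j)
  let C : Matrix (Fin 1) (Fin r) A := M.submatrix (fun _ => i) f
  let D : Matrix (Fin 1) (Fin 1) A := M.submatrix (fun _ => i) (fun _ => j)
  have hdet : (fromBlocks B E C D).det = 0 := by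
    have hmem : (M.submatrix (Sum.elim e (fun _ => i) ∘ finSumFinEquiv.symm)
        (Sum.elim f (fun _ => j) ∘ finSumFinEquiv.symm)).det ∈ minorsIdeal M (r + 1) :=
      Ideal.subset_span ⟨_, _, rfl⟩
    rw [hM, Ideal.mem_bot] at hmem
    rw [← hmem, ← submatrix_submatrix, det_submatrix_equiv_self]
    congr 1
    ext (a | a) (b | b) <;> rfl
  have hmul : fromBlocks B E C D * fromBlocks B.adjugate (-(B.adjugate * E)) 0 (B.det • 1) =
      fromBlocks (B.det • 1) 0 (C * B.adjugate) (B.det • D - C * B.adjugate * E) := by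
    rw [fromBlocks_multiply]
    congr 1
    · simp [mul_adjugate]
    · simp [← Matrix.mul_assoc, mul_adjugate]
    · simp
    · simp [← Matrix.mul_assoc, sub_eq_neg_add]
  have hz := congrArg Matrix.det hmul
  rw [det_mul, hdet, zero_mul, det_fromBlocks_zero₁₂, det_smul, det_one, mul_one,
    eq_comm, mul_eq_zero, or_iff_right (pow_ne_zero _ h0), det_fin_one] at hz
  rw [Matrix.sub_apply, sub_eq_zero] at hz
  exact hz

theorem minorsIdeal_eq_bot_of_lt {A : Type*} [CommRing A] {p q : ℕ} (M : Matrix (Fin p) (Fin q) A)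
    {r : ℕ} (h : p < r) : minorsIdeal M r = ⊥ := by
  rw [minorsIdeal, Ideal.span_eq_bot]
  rintro _ ⟨e, f, rfl⟩
  obtain ⟨a, b, hab, he⟩ := Fintype.exists_ne_map_eq_of_card_lt e (by simpa using h)
  exact Matrix.det_zero_of_row_eq hab (by ext; simp [he])

theorem minorsIdeal_minorsRank_add_one {A : Type*} [CommRing A] {p q : ℕ}
    (M : Matrix (Fin p) (Fin q) A) : minorsIdeal M (minorsRank M + 1) = ⊥ := by
  by_contra h
  -- Without this bound, `sSup` in `ℕ` would be the default value `0`.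
  have hb : BddAbove {r : ℕ | minorsIdeal M r ≠ ⊥} :=
    ⟨p, fun r hr => le_of_not_gt fun hlt => hr (minorsIdeal_eq_bot_of_lt M hlt)⟩
  have : minorsRank M + 1 ≤ minorsRank M := le_csSup hb h
  omega

/-- Selecting columns or rows is multiplication by a matrix on the right or left, so the minor
identity becomes `ΔM = M(U adj V)M`. -/
theorem exists_comp_comp_eq_smul {A : Type*} [CommRing A] [IsDomain A] {p q : ℕ} {G F : Type*}
    [AddCommGroup G] [Module A G] [AddCommGroup F] [Module A F]
    (bG : Module.Basis (Fin q) A G) (bF : Module.Basis (Fin p) A F) (d : G →ₗ[A] F) (P : Ideal A)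
    (hP : ¬ maximalMinorsIdeal (LinearMap.toMatrix bG bF d) ≤ P) :
    ∃ Δ, Δ ∉ P ∧ ∃ ψ : F →ₗ[A] G, d ∘ₗ ψ ∘ₗ d = Δ • d := by
  set M := LinearMap.toMatrix bG bF d with hM
  rw [maximalMinorsIdeal, minorsIdeal, Ideal.span_le, Set.not_subset] at hP
  obtain ⟨_, ⟨e, f, rfl⟩, hΔ⟩ := hP
  have h0 : (M.submatrix e f).det ≠ 0 := fun h => hΔ (h ▸ P.zero_mem)
  obtain ⟨U, hU⟩ : ∃ U : Matrix (Fin q) (Fin (minorsRank M)) A, M.submatrix id f = M * U :=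
    ⟨(1 : Matrix (Fin q) (Fin q) A).submatrix id f, by
      ext; simp [Matrix.mul_apply, Matrix.one_apply]⟩
  obtain ⟨V, hV⟩ : ∃ V : Matrix (Fin (minorsRank M)) (Fin p) A, M.submatrix e id = V * M :=
    ⟨(1 : Matrix (Fin p) (Fin p) A).submatrix e id, by
      ext; simp [Matrix.mul_apply, Matrix.one_apply]⟩
  refine ⟨_, hΔ, Matrix.toLin bF bG (U * (M.submatrix e f).adjugate * V), ?_⟩
  apply (LinearMap.toMatrix bG bF).injective
  rw [LinearMap.toMatrix_comp bG bG bF, LinearMap.toMatrix_comp bG bF bG, LinearMap.toMatrix_toLin,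
    map_smul, ← hM, Matrix.det_smul_eq_mul_adjugate_mul M e f h0 (minorsIdeal_minorsRank_add_one M),
    hU, hV]
  simp only [Matrix.mul_assoc]

/-! ### Depth is bounded by height -/

-- In `A_P` the sequence becomes regular, and each term lowers the dimension by one.
open RingTheory.Sequence in
theorem length_le_height_of_isWeaklyRegular {A : Type*} [CommRing A] [IsNoetherianRing A]
    (P : Ideal A) [P.IsPrime] (rs : List A) (h : IsWeaklyRegular A rs) (hmem : ∀ r ∈ rs, r ∈ P) :
    (rs.length : ℕ∞) ≤ P.height := by
  have hreg := h.isRegular_of_isLocalization_of_mem (Localization.AtPrime P) P hmem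
  have hdim := ringKrullDim_add_length_eq_ringKrullDim_of_isRegular _ hreg
  rw [List.length_map, IsLocalization.AtPrime.ringKrullDim_eq_height P (Localization.AtPrime P)] at hdim
  have : Nontrivial (Localization.AtPrime P ⧸
      Ideal.ofList (rs.map (algebraMap A (Localization.AtPrime P)))) := by
    rw [Ideal.Quotient.nontrivial_iff]
    have := hreg.top_ne_smul
    rw [smul_eq_mul, Ideal.mul_top] at this
    exact this.symm
  have h0 := ringKrullDim_nonneg_of_nontrivial (R := Localization.AtPrime P ⧸
      Ideal.ofList (rs.map (algebraMap A (Localization.AtPrime P))))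
  have : (rs.length : WithBot ℕ∞) ≤ (P.height : WithBot ℕ∞) := by
    rw [← hdim]
    exact le_add_of_nonneg_left h0
  exact_mod_cast this

theorem idealDepth_le_height {A : Type*} [CommRing A] [IsNoetherianRing A]
    {J P : Ideal A} [P.IsPrime] (h : J ≤ P) : idealDepth J ≤ P.height := by
  have hJ : J ≠ ⊤ := fun h' => Ideal.IsPrime.ne_top ‹P.IsPrime› (top_le_iff.1 (h' ▸ h))
  rw [idealDepth, if_neg hJ]
  exact iSup_le fun rs => iSup_le fun hreg => iSup_le fun hmem =>
    length_le_height_of_isWeaklyRegular P rs hreg.1 fun a ha => h (hmem a ha)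

/-! ### Affine space and prime ideals -/

theorem isClosed_iff_mem_range_zeroSet {N : ℕ} {Z : Set (ComplexAffineSpace N)} :
    IsClosed Z ↔ Z ∈ Set.range (zeroSet (N := N)) := by
  rw [← isOpen_compl_iff]
  change Zᶜᶜ ∈ _ ↔ _
  rw [compl_compl]

/-- The ideal of polynomials vanishing on a subset of affine space. -/
noncomputable def vanishingIdealOf {N : ℕ} (Z : Set (ComplexAffineSpace N)) : Ideal (MvPolynomial (Fin N) ℂ) :=
  MvPolynomial.vanishingIdeal ℂ (K := ℂ) (σ := Fin N) Z

theorem mem_vanishingIdealOf {N : ℕ} {Z : Set (ComplexAffineSpace N)}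
    {f : MvPolynomial (Fin N) ℂ} :
    f ∈ vanishingIdealOf Z ↔ ∀ x ∈ Z, MvPolynomial.eval x f = 0 :=
  Iff.rfl

theorem vanishingIdealOf_zeroSet {N : ℕ} (I : Ideal (MvPolynomial (Fin N) ℂ)) :
    vanishingIdealOf (zeroSet I) = I.radical :=
  MvPolynomial.vanishingIdeal_zeroLocus_eq_radical (K := ℂ) (k := ℂ) I

theorem zeroSet_vanishingIdealOf {N : ℕ} {Z : Set (ComplexAffineSpace N)} (hZ : IsClosed Z) :
    zeroSet (vanishingIdealOf Z) = Z := by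
  obtain ⟨J, rfl⟩ := isClosed_iff_mem_range_zeroSet.1 hZ
  exact Set.Subset.antisymm (fun x hx f hf => hx f fun y hy => hy f hf) fun x hx f hf => hf x hx

theorem isPrime_vanishingIdealOf {N : ℕ} {Z : Set (ComplexAffineSpace N)} (hZ : IsIrreducible Z) :
    (vanishingIdealOf Z).IsPrime := by
  obtain ⟨⟨x, hx⟩, hirr⟩ := hZ
  refine ⟨fun h => ?_, fun {f g} hfg => ?_⟩
  · have h1 : (1 : MvPolynomial (Fin N) ℂ) ∈ vanishingIdealOf Z := h ▸ Submodule.mem_top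
    simpa using mem_vanishingIdealOf.1 h1 x hx
  · have hclosed (a : MvPolynomial (Fin N) ℂ) : IsClosed (zeroSet (Ideal.span {a})) :=
      isClosed_iff_mem_range_zeroSet.2 ⟨_, rfl⟩
    have hmem (a : MvPolynomial (Fin N) ℂ) (y : ComplexAffineSpace N)
        (h : MvPolynomial.eval y a = 0) : y ∈ zeroSet (Ideal.span {a}) := by
      intro b hb
      obtain ⟨c, rfl⟩ := Ideal.mem_span_singleton.1 hb
      rw [map_mul, h, zero_mul]
    have hcover : Z ⊆ zeroSet (Ideal.span {f}) ∪ zeroSet (Ideal.span {g}) := by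
      intro y hy
      have := mem_vanishingIdealOf.1 hfg y hy
      rw [map_mul, mul_eq_zero] at this
      exact this.imp (hmem f y) (hmem g y)
    refine (isPreirreducible_iff_isClosed_union_isClosed.1 hirr _ _ (hclosed f) (hclosed g)
      hcover).imp ?_ ?_
    · exact fun h y hy => h hy f (Ideal.mem_span_singleton_self f)
    · exact fun h y hy => h hy g (Ideal.mem_span_singleton_self g)

/-- Closed sets are recovered from their vanishing ideals, so chains above `Z` give strict chains of
primes. Only this inequality is needed. -/
theorem topologicalCodim_le_height_vanishingIdealOf {N : ℕ} {Z : Set (ComplexAffineSpace N)}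
    (hZ : IsIrreducible Z) (hc : IsClosed Z) :
    topologicalCodim Z ≤ (vanishingIdealOf Z).height := by
  let φ : TopologicalSpace.IrreducibleCloseds (ComplexAffineSpace N) →
      (PrimeSpectrum (MvPolynomial (Fin N) ℂ))ᵒᵈ := fun W =>
    OrderDual.toDual ⟨vanishingIdealOf (W : Set (ComplexAffineSpace N)), isPrime_vanishingIdealOf W.isIrreducible⟩
  have hle : ∀ {W W' : TopologicalSpace.IrreducibleCloseds (ComplexAffineSpace N)},
      φ W ≤ φ W' ↔ W ≤ W' := by
    intro W W'
    constructor
    · intro h x hx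
      change x ∈ (W' : Set (ComplexAffineSpace N))
      rw [← zeroSet_vanishingIdealOf W'.isClosed]
      intro f hf
      exact (show vanishingIdealOf (W' : Set (ComplexAffineSpace N)) ≤ vanishingIdealOf (W : Set (ComplexAffineSpace N)) from h) hf x hx
    · intro h
      change vanishingIdealOf (W' : Set (ComplexAffineSpace N)) ≤ vanishingIdealOf (W : Set (ComplexAffineSpace N))
      exact fun f hf x hx => hf x (h hx)
  have hφ : StrictMono φ := fun W W' h => by
    rw [lt_iff_le_not_ge] at h ⊢
    exact ⟨hle.2 h.1, fun h' => h.2 (hle.1 h')⟩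
  let W : TopologicalSpace.IrreducibleCloseds (ComplexAffineSpace N) := ⟨Z, hZ, hc⟩
  have h1 := Order.coheight_le_coheight_apply_of_strictMono φ hφ W
  have h2 := PrimeSpectrum.height_eq_orderHeight
    ⟨vanishingIdealOf Z, isPrime_vanishingIdealOf hZ⟩
  rw [show topologicalCodim Z = Order.coheight W from topologicalCodim_coe W]
  exact h1.trans h2.ge

/-! ### Associated primes and the conclusion -/

open RingTheory.Sequence in
/-- If the ideals of maximal minors of the differentials of a finite free resolution of `M` have depth
greater than their index beyond the index `c`, then every prime associated to `M` has height at
most `c`. -/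
theorem height_le_of_mem_associatedPrimes {A : Type u} [CommRing A] [IsDomain A]
    [IsNoetherianRing A] (hA : HasLongRegularSequences A) {M : Type w} [AddCommGroup M] [Module A M]
    (c n : ℕ) (F : ℕ → Type v) [∀ k, AddCommGroup (F k)] [∀ k, Module A (F k)]
    (r : ℕ → ℕ) (b : ∀ k, Module.Basis (Fin (r k)) A (F k))
    (d : ∀ k, F (k + 1) →ₗ[A] F k) (ε : F 0 →ₗ[A] M) (hF : IsResolution d ε n)
    (hdepth : ∀ k, c < k + 1 → k + 1 ≤ n →
      ((k + 1 : ℕ) : ℕ∞) <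
        idealDepth (maximalMinorsIdeal (LinearMap.toMatrix (b (k + 1)) (b k) (d k))))
    (P : Ideal A) (hP : P ∈ associatedPrimes A M) : P.height ≤ c := by
  obtain ⟨hprime, z, hz⟩ := isAssociatedPrime_iff.1 hP
  by_contra! hlt
  obtain ⟨k, hk⟩ := ENat.ne_top_iff_exists.1 (P.height_ne_top_of_isPrime)
  rw [← hk, Nat.cast_lt] at hlt
  obtain ⟨k, rfl⟩ : ∃ j, k = j + 1 := ⟨k - 1, by omega⟩
  obtain ⟨rs, hmem, hreg, hlen⟩ := hA P
  rw [← hk, Nat.cast_le] at hlen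
  let S := P.primeCompl
  have hfree (i) : Module.Free A (F i) := Module.Free.of_basis (b i)
  have hregF (i) : IsWeaklyRegular (LocalizedModule S (F i)) rs :=
    hreg.isWeaklyRegular_localization.localizedModule_of_flat S (F i)
  obtain ⟨m, hm, Δ, hΔ, ψ, hψ⟩ : ∃ m < rs.length, ∃ Δ ∈ S, ∃ ψ : F m →ₗ[A] F (m + 1),
      d m ∘ₗ ψ ∘ₗ d m = Δ • d m := by
    by_cases hkn : k + 1 ≤ n
    · obtain ⟨Δ, hΔ, ψ, hψ⟩ := exists_comp_comp_eq_smul (b (k + 1)) (b k) (d k) P fun hle =>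
        ((hdepth k hlt hkn).trans_le (idealDepth_le_height hle)).ne hk
      exact ⟨k, by omega, Δ, hΔ, ψ, hψ⟩
    -- Past the end of the resolution `d n` is zero, so `Δ = 1` and `ψ = 0` serve.
    · have := hF.eq_zero (n + 1) n.lt_succ_self
      exact ⟨n, by omega, 1, S.one_mem, 0, LinearMap.ext fun x => by
        rw [Subsingleton.elim x 0]; simp⟩
  have hε : LinearMap.range (d 0) ≤ LinearMap.ker ε := hF.exact_zero.linearMap_ker_eq.ge
  let η : (F 0 ⧸ LinearMap.range (d 0)) →ₗ[A] M := (LinearMap.range (d 0)).liftQ ε hε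
  obtain ⟨y, rfl⟩ := hF.surjective z
  have hker {x : F 0} : Submodule.Quotient.mk (p := LinearMap.range (d 0)) x = 0 ↔ ε x = 0 := by
    rw [Submodule.Quotient.mk_eq_zero]
    exact (hF.exact_zero x).symm
  have hdd (i) : LinearMap.range (d (i + 1)) ≤ LinearMap.ker (d i) :=
    (hF.exact_succ i).linearMap_ker_eq.ge
  -- The resolution splits into short exact sequences `0 → coker d (i + 1) → F i → coker d i → 0`.
  let f (i : ℕ) : (F (i + 1) ⧸ LinearMap.range (d (i + 1))) →ₗ[A] F i :=
    (LinearMap.range (d (i + 1))).liftQ (d i) (hdd i)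
  let g (i : ℕ) : F i →ₗ[A] (F i ⧸ LinearMap.range (d i)) := (LinearMap.range (d i)).mkQ
  have hf (i) : Function.Injective (f i) := LinearMap.ker_eq_bot.1 <|
    Submodule.ker_liftQ_eq_bot' _ _ (hF.exact_succ i).linearMap_ker_eq.symm
  have hfg (i) : Function.Exact (f i) (g i) := by
    rw [LinearMap.exact_iff]
    simp only [f, g, Submodule.ker_mkQ, Submodule.range_liftQ]
  let Kl (i : ℕ) := LocalizedModule S (F i ⧸ LinearMap.range (d i))
  let ι (i : ℕ) := LocalizedModule.mkLinearMap S (F i)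
  let κ (i : ℕ) := LocalizedModule.mkLinearMap S (F i ⧸ LinearMap.range (d i))
  have hzero := eq_zero_of_forall_smul_eq_zero_of_resolution m Kl
    (fun i => LocalizedModule S (F i))
    (fun i => IsLocalizedModule.map S (κ (i + 1)) (ι i) (f i))
    (fun i => IsLocalizedModule.map S (ι i) (κ i) (g i))
    (fun i _ => IsLocalizedModule.map_injective S _ _ _ (hf i))
    (fun i _ => IsLocalizedModule.map_exact S _ _ _ _ _ (hfg i))
    (fun i _ => IsLocalizedModule.map_surjective S _ _ _ (Submodule.mkQ_surjective _))
    rs hm (fun i _ => hregF i) ((hregF m).localizedModule_coker S (d m) ψ hΔ hψ)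
    (κ 0 (Submodule.Quotient.mk y)) fun a ha => by
      have hay : a • ε y = 0 := by
        have : a ∈ P := hmem a ha
        rwa [hz, Submodule.mem_colon_singleton, Submodule.mem_bot] at this
      rw [← map_smul, ← Submodule.Quotient.mk_smul, hker.2 (by rw [map_smul, hay]), map_zero]
  obtain ⟨s, hs⟩ := (IsLocalizedModule.eq_zero_iff S (κ 0)).1 hzero
  rw [Submonoid.smul_def, ← Submodule.Quotient.mk_smul, hker, map_smul] at hs
  refine s.2 ?_
  rw [hz, SetLike.mem_coe, Submodule.mem_colon_singleton, Submodule.mem_bot]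
  exact hs

/-- An associated prime of `A/I` as a ring contracts to one as an `A`-module, hence to `√I`, which
lies in every prime over `I`. -/
theorem satisfiesS1_of_associatedPrimes_eq_radical {A : Type*} [CommRing A] (I : Ideal A)
    (h : associatedPrimes A (A ⧸ I) ⊆ {I.radical}) : SatisfiesS1 (A ⧸ I) := by
  intro Q hQ
  have hQp : Q.IsPrime := hQ.1
  have hcomap : Q.comap (Ideal.Quotient.mk I) = I.radical := by
    refine h ⟨Ideal.IsPrime.comap _, ?_⟩
    obtain ⟨-, x, hx⟩ := hQ
    refine ⟨x, ?_⟩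
    rw [hx, Ideal.comap_radical]
    congr 1
  rw [Ideal.height_eq_zero_iff]
  refine ⟨⟨hQp, bot_le⟩, fun Q' hQ' _ => ?_⟩
  have hQ'p : Q'.IsPrime := hQ'.1
  rw [← Ideal.comap_le_comap_iff_of_surjective _ Ideal.Quotient.mk_surjective, hcomap]
  have : (Q'.comap (Ideal.Quotient.mk I)).IsPrime := Ideal.IsPrime.comap _
  refine Ideal.IsPrime.radical_le_iff this |>.2 fun a ha => ?_
  rw [Ideal.mem_comap, Ideal.Quotient.eq_zero_iff_mem.2 ha]
  exact Q'.zero_mem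

/-- Here `d k : F (k + 1) → F k` is the differential usually written `d_{k+1}`, and its matrix is
taken in the bases `b`, so that the hypothesis `hdepth` reads `depth I(d_j) > j` for `c < j ≤ n`. -/
theorem proposition5p3 (N : ℕ) (I : Ideal (MvPolynomial (Fin N) ℂ)) (c : ℕ)
    (hirr : IsIrreducible (zeroSet I)) (hcodim : topologicalCodim (zeroSet I) = c)
    (n : ℕ) (F : ℕ → Type*) [∀ k, AddCommGroup (F k)]
    [∀ k, Module (MvPolynomial (Fin N) ℂ) (F k)]
    (r : ℕ → ℕ) (b : ∀ k, Module.Basis (Fin (r k)) (MvPolynomial (Fin N) ℂ) (F k))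
    (d : ∀ k, F (k + 1) →ₗ[MvPolynomial (Fin N) ℂ] F k)
    (ε : F 0 →ₗ[MvPolynomial (Fin N) ℂ] (MvPolynomial (Fin N) ℂ ⧸ I))
    (hF : IsResolution d ε n)
    (hdepth : ∀ k, c < k + 1 → k + 1 ≤ n →
      ((k + 1 : ℕ) : ℕ∞) <
        idealDepth (maximalMinorsIdeal (LinearMap.toMatrix (b (k + 1)) (b k) (d k)))) :
    associatedPrimes (MvPolynomial (Fin N) ℂ) (MvPolynomial (Fin N) ℂ ⧸ I) = {I.radical} ∧
      SatisfiesS1 (MvPolynomial (Fin N) ℂ ⧸ I) := by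
  have hrad : I.radical.IsPrime := vanishingIdealOf_zeroSet I ▸ isPrime_vanishingIdealOf hirr
  have hc : (c : ℕ∞) ≤ I.radical.height := by
    rw [← hcodim, ← vanishingIdealOf_zeroSet]
    exact topologicalCodim_le_height_vanishingIdealOf hirr
      (isClosed_iff_mem_range_zeroSet.2 ⟨I, rfl⟩)
  have hsub : associatedPrimes (MvPolynomial (Fin N) ℂ) (MvPolynomial (Fin N) ℂ ⧸ I) ⊆
      {I.radical} := by
    intro P hP
    have hPp : P.IsPrime := hP.1
    have hle : I.radical ≤ P := by
      refine hPp.radical_le_iff.2 ?_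
      have := IsAssociatedPrime.annihilator_le hP
      rwa [Submodule.annihilator_top, Ideal.annihilator_quotient] at this
    exact (Ideal.eq_of_le_of_height_le _ hle ((height_le_of_mem_associatedPrimes
      (.mvPolynomial_fin ℂ N) c n F r b d ε hF hdepth P hP).trans hc)).symm
  refine ⟨?_, satisfiesS1_of_associatedPrimes_eq_radical I hsub⟩
  have : Nontrivial (MvPolynomial (Fin N) ℂ ⧸ I) := Ideal.Quotient.nontrivial_iff.2 fun h =>
    hrad.ne_top (by rw [h, Ideal.radical_top])
  exact (associatedPrimes.nonempty _ _).subset_singleton_iff.1 hsub
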